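/- Let $a>0$, $\alpha\in(0,1)$ and $\alpha'=\sqrt{1-\alpha^2}$. Let $\operatorname{sn}(\cdot\,;\alpha)$ denote the Jacobi elliptic sine of modulus $\alpha$, that is, $\operatorname{sn}(t;\alpha)=\sin\varphi$ where $\varphi\in\mathbb R$ is determined by $t=\int_0^{\varphi}\frac{d\theta}{\sqrt{1-\alpha^2\sin^2\theta}}$, and let $\mathrm K(\alpha)=\int_0^{\pi/2}\frac{d\theta}{\sqrt{1-\alpha^2\sin^2\theta}}$ be the complete elliptic integral of the first kind. Then for every $(x,y)\in\mathbb R^2$ the equation $$\operatorname{sn}\left(\frac{az}{\alpha'};\alpha\right)=\frac{\cos ax}{\cosh ay}$$ has exactly one real solution $z=u_{a,\alpha}(x,y)$ in the slab $\left|\frac{az}{\alpha'}\right|\le \mathrm K(\alpha)$. The function $u=u_{a,\alpha}$ so defined is continuous on $\mathbb R^2$. Let $\Sigma=\{(\pi k/a,0): k\in\mathbb Z\}$. On $\mathbb R^2\setminus\Sigma$ the function $u$ is real analytic, it is space-like, i.e. $|\nabla u|=\sqrt{u_x^2+u_y^2}<1$, and it solves the maximal surface equation $$(1-u_y^2)\,u_{xx}+2u_xu_y\,u_{xy}+(1-u_x^2)\,u_{yy}=0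 .$$ At the points of $\Sigma$ the function $u$ is not real analytic. -/

import Mathlib

noncomputable section

/-- The incomplete elliptic integral of the first kind with modulus `k`, in Legendre form
`F(φ, k) = ∫₀^φ dθ / √(1 - k² sin² θ)`. -/
def ellipticF (k φ : ℝ) : ℝ :=
  ∫ θ in (0 : ℝ)..φ, 1 / Real.sqrt (1 - k ^ 2 * Real.sin θ ^ 2)

/-- The complete elliptic integral of the first kind `K(k) = F(π/2, k)`. -/
def ellipticK (k : ℝ) : ℝ := ellipticF k (Real.pi / 2)

/-- The Jacobi amplitude: the inverse function of `φ ↦ F(φ, k)`, which is a bijection of `ℝ`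
for `|k| < 1` (`ellipticF_bijective` below). -/
def jacobiAm (t k : ℝ) : ℝ := Function.invFun (ellipticF k) t

/-- The Jacobi elliptic sine `sn(t; k) = sin (am(t; k))`, for all real `t`.  Substituting
`u = sin θ`, for `|t| ≤ K(k)` this is the inverse of
`s ↦ ∫₀^s du / √((1 - u²)(1 - k² u²))` on `[-1, 1]`. -/
def jacobiSn (t k : ℝ) : ℝ := Real.sin (jacobiAm t k)

/-- The partial derivative `u_x`. -/
def partialX (u : ℝ × ℝ → ℝ) (p : ℝ × ℝ) : ℝ := deriv (fun s => u (s, p.2)) p.1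

/-- The partial derivative `u_y`. -/
def partialY (u : ℝ × ℝ → ℝ) (p : ℝ × ℝ) : ℝ := deriv (fun s => u (p.1, s)) p.2

/-- The equation `(1 - u_y²) u_xx + 2 u_x u_y u_xy + (1 - u_x²) u_yy = 0` at the point `p`. -/
def MaximalSurfaceEqAt (u : ℝ × ℝ → ℝ) (p : ℝ × ℝ) : Prop :=
  (1 - partialY u p ^ 2) * partialX (partialX u) p
    + 2 * partialX u p * partialY u p * partialY (partialX u) p
    + (1 - partialX u p ^ 2) * partialY (partialY u) p = 0

/-- The graph of `u` is space-like at `p`: `|∇u(p)| < 1`, with the Euclidean length. -/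
def SpaceLikeAt (u : ℝ × ℝ → ℝ) (p : ℝ × ℝ) : Prop :=
  Real.sqrt (partialX u p ^ 2 + partialY u p ^ 2) < 1

/-- `u` is a space-like `C²` solution of the maximal surface equation on the open set `U`. -/
structure IsSpaceLikeSolutionOn (u : ℝ × ℝ → ℝ) (U : Set (ℝ × ℝ)) : Prop where
  isOpen : IsOpen U
  contDiffOn : ContDiffOn ℝ 2 u U
  spaceLike : ∀ p ∈ U, SpaceLikeAt u p
  equation : ∀ p ∈ U, MaximalSurfaceEqAt u p

/-- The set of points `(πk/a, 0)`, `k ∈ ℤ`. -/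
def singularPoints (a : ℝ) : Set (ℝ × ℝ) :=
  {p | ∃ k : ℤ, p = (Real.pi * k / a, 0)}

theorem ellipticF_integrand_pos {k : ℝ} (hk : |k| < 1) (θ : ℝ) :
    0 < 1 - k ^ 2 * Real.sin θ ^ 2 := by
  have h1 : k ^ 2 < 1 := (sq_lt_one_iff_abs_lt_one k).2 hk
  nlinarith [Real.sin_sq_le_one θ, sq_nonneg (Real.sin θ), sq_nonneg k]

theorem ellipticF_integrand_continuous {k : ℝ} (hk : |k| < 1) :
    Continuous fun θ : ℝ => 1 / Real.sqrt (1 - k ^ 2 * Real.sin θ ^ 2) := by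
  refine continuous_const.div (by fun_prop) fun θ => ?_
  exact (Real.sqrt_pos.2 (ellipticF_integrand_pos hk θ)).ne'

theorem ellipticF_hasDerivAt {k : ℝ} (hk : |k| < 1) (φ : ℝ) :
    HasDerivAt (ellipticF k) (1 / Real.sqrt (1 - k ^ 2 * Real.sin φ ^ 2)) φ :=
  ((ellipticF_integrand_continuous hk).integral_hasStrictDerivAt 0 φ).hasDerivAt

theorem ellipticF_sub_id_monotone {k : ℝ} (hk : |k| < 1) :
    Monotone fun φ => ellipticF k φ - φ := by
  have hd : ∀ φ, HasDerivAt (fun φ => ellipticF k φ - φ)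
      (1 / Real.sqrt (1 - k ^ 2 * Real.sin φ ^ 2) - 1) φ := fun φ =>
    (ellipticF_hasDerivAt hk φ).sub (hasDerivAt_id φ)
  refine monotone_of_deriv_nonneg (fun φ => (hd φ).differentiableAt) fun φ => ?_
  rw [(hd φ).deriv, sub_nonneg, le_div_iff₀ (Real.sqrt_pos.2 (ellipticF_integrand_pos hk φ)),
    one_mul]
  refine Real.sqrt_le_iff.2 ⟨zero_le_one, ?_⟩
  nlinarith [mul_nonneg (sq_nonneg k) (sq_nonneg (Real.sin φ))]

theorem ellipticF_zero (k : ℝ) : ellipticF k 0 = 0 := by simp [ellipticF]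

theorem ellipticF_bijective {k : ℝ} (hk : |k| < 1) : Function.Bijective (ellipticF k) := by
  have hm := ellipticF_sub_id_monotone hk
  have hc : Continuous (ellipticF k) :=
    continuous_iff_continuousAt.2 fun φ => (ellipticF_hasDerivAt hk φ).continuousAt
  constructor
  · have hs : StrictMono (ellipticF k) := fun x y hxy => by
      have := hm hxy.le
      simp only at this
      linarith
    exact hs.injective
  · refine hc.surjective ?_ ?_
    · refine Filter.tendsto_atTop_mono' _ ?_ Filter.tendsto_id
      filter_upwards [Filter.eventually_ge_atTop 0] with x hx
      have := hm hx
      simp only [ellipticF_zero] at this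
      simp only [id]
      linarith
    · refine Filter.tendsto_atBot_mono' _ ?_ Filter.tendsto_id
      filter_upwards [Filter.eventually_le_atBot 0] with x hx
      have := hm hx
      simp only [ellipticF_zero] at this
      simp only [id]
      linarith

end

/-! For |t| ≤ K(α) the amplitude lies in [-π/2, π/2], where sine is inverted by arcsin. So the
solution is explicit: u = (α'/a) F(arcsin q) with q = cos ax / cosh ay ∈ [-1, 1]
(`abs_le_ellipticK_and_jacobiSn_eq_iff`). F is analytic on ℝ, arcsin is analytic away from ±1, and q
= ±1 only on Σ.

Put C = cos² ax, H = cosh² ay, D = (H - C)(H - α²C). By the chain rule u_x and u_y are elementary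
functions over √D (`HasDerivAt.ellipticF_arcsin`), and |∇u|² = (1 - α²)/(H - α²C) < 1 off Σ. The
second derivatives turn the equation into `maximalGraph_polynomial_identity`.

On the vertical line through a point of Σ, u is even in y, so analyticity would force u_y = 0 there;
but u_y² → 1 along that line. -/

open Filter Topology

/-! ### Real analyticity of F -/

/-- A real function whose derivative near `x` is the real part of a holomorphic function is
real analytic at `x`. -/
theorem analyticAt_of_hasDerivAt_re {F : ℝ → ℝ} {g : ℂ → ℂ} {x : ℝ}
    (hg : ∀ᶠ z in 𝓝 (x : ℂ), DifferentiableAt ℂ g z)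
    (hF : ∀ᶠ t : ℝ in 𝓝 x, HasDerivAt F (g t).re t) : AnalyticAt ℝ F x := by
  obtain ⟨r, hr, hgr⟩ := Metric.eventually_nhds_iff_ball.1 hg
  obtain ⟨s, hs, hFs⟩ := Metric.eventually_nhds_iff_ball.1 hF
  -- `G` is a holomorphic primitive of `g` on the disc; on the real axis `F - Re G` has zero
  -- derivative, so it is constant.
  obtain ⟨G, hG⟩ := DifferentiableOn.isExactOn_ball (f := g) (c := (x : ℂ)) (r := r)
    fun z hz => (hgr z hz).differentiableWithinAt
  have hGx : AnalyticAt ℂ G x := by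
    rw [Complex.analyticAt_iff_eventually_differentiableAt]
    filter_upwards [Metric.ball_mem_nhds (x : ℂ) hr] with z hz
    exact (hG z hz).differentiableAt
  have hGr : AnalyticAt ℝ (fun t : ℝ => (G t).re + (F x - (G x).re)) x :=
    hGx.re_ofReal.add analyticAt_const
  refine hGr.congr ?_
  have hm : 0 < min r s := lt_min hr hs
  have hball : ∀ t ∈ Metric.ball x (min r s), (t : ℂ) ∈ Metric.ball (x : ℂ) r := by
    intro t ht
    have := lt_of_lt_of_le (Metric.mem_ball.1 ht) (min_le_left r s)
    rw [Metric.mem_ball, Complex.dist_eq, ← Complex.ofReal_sub, Complex.norm_real]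
    simpa [Real.dist_eq] using this
  have hd : ∀ t ∈ Metric.ball x (min r s), HasDerivAt (fun t : ℝ => F t - (G t).re) 0 t := by
    intro t ht
    have h1 := hFs t (Metric.ball_subset_ball (min_le_right r s) ht)
    have h2 := (hG t (hball t ht)).real_of_complex
    simpa using! h1.sub h2
  filter_upwards [Metric.ball_mem_nhds x hm] with t ht
  have := (convex_ball x (min r s)).is_const_of_fderivWithin_eq_zero (𝕜 := ℝ)
    (f := fun t : ℝ => F t - (G t).re)
    (fun t ht => (hd t ht).differentiableAt.differentiableWithinAt)
    (fun t ht => by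
      rw [fderivWithin_of_isOpen Metric.isOpen_ball ht]
      ext
      simp [(hd t ht).deriv]) ht (Metric.mem_ball_self hm)
  linarith

/-- The integrand extends holomorphically as a principal power, because its radicand is positive on
the real axis and so stays in the slit plane nearby. -/
theorem ellipticF_analyticAt {k : ℝ} (hk : |k| < 1) (φ : ℝ) : AnalyticAt ℝ (ellipticF k) φ := by
  have hs : ∀ t : ℝ, (1 - (k : ℂ) ^ 2 * Complex.sin t ^ 2) =
      ((1 - k ^ 2 * Real.sin t ^ 2 : ℝ) : ℂ) := fun t => by push_cast; rfl
  refine analyticAt_of_hasDerivAt_re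
    (g := fun z => (1 - (k : ℂ) ^ 2 * Complex.sin z ^ 2) ^ (-(1 / 2) : ℂ)) ?_ ?_
  · have hc : ContinuousAt (fun z : ℂ => 1 - (k : ℂ) ^ 2 * Complex.sin z ^ 2) (φ : ℂ) := by
      fun_prop
    have hmem : (1 - (k : ℂ) ^ 2 * Complex.sin (φ : ℂ) ^ 2) ∈ Complex.slitPlane := by
      rw [hs]
      exact Complex.ofReal_mem_slitPlane.2 (ellipticF_integrand_pos hk φ)
    filter_upwards [hc.eventually (Complex.isOpen_slitPlane.mem_nhds hmem)] with z hz
    exact DifferentiableAt.cpow (by fun_prop) (by fun_prop) hz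
  · refine Eventually.of_forall fun t : ℝ => ?_
    have hp := ellipticF_integrand_pos hk t
    convert! ellipticF_hasDerivAt hk t using 1
    have he : (-(1 / 2) : ℂ) = ((-(1 / 2) : ℝ) : ℂ) := by push_cast; rfl
    rw [hs, he, ← Complex.ofReal_cpow hp.le, Complex.ofReal_re, Real.rpow_neg hp.le,
      ← Real.sqrt_eq_rpow, one_div]

/-! ### Inverting sn on [-K, K] -/

theorem ellipticF_neg (k φ : ℝ) : ellipticF k (-φ) = -ellipticF k φ := by
  unfold ellipticF
  have := intervalIntegral.integral_comp_neg (a := 0) (b := φ)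
    (fun θ : ℝ => 1 / Real.sqrt (1 - k ^ 2 * Real.sin θ ^ 2))
  simp only [Real.sin_neg, neg_sq, neg_zero] at this
  rw [this, intervalIntegral.integral_symm]

theorem ellipticF_strictMono {k : ℝ} (hk : |k| < 1) : StrictMono (ellipticF k) := fun x y hxy => by
  have := ellipticF_sub_id_monotone hk hxy.le
  simp only at this
  linarith

theorem jacobiAm_ellipticF {k : ℝ} (hk : |k| < 1) (φ : ℝ) : jacobiAm (ellipticF k φ) k = φ :=
  Function.leftInverse_invFun (ellipticF_bijective hk).injective φ

/-- On `[-K, K]` the function `sn` is inverted by `c ↦ F(arcsin c)`. -/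
theorem abs_le_ellipticK_and_jacobiSn_eq_iff {k c : ℝ} (hk : |k| < 1) (hc : c ∈ Set.Icc (-1) 1)
    (t : ℝ) : (|t| ≤ ellipticK k ∧ jacobiSn t k = c) ↔ t = ellipticF k (Real.arcsin c) := by
  -- With t = F(φ), the slab becomes |φ| ≤ π/2 and sn becomes sin φ.
  obtain ⟨φ, rfl⟩ := (ellipticF_bijective hk).surjective t
  have hm {x y : ℝ} := (ellipticF_strictMono hk).le_iff_le (a := x) (b := y)
  rw [jacobiSn, jacobiAm_ellipticF hk, (ellipticF_bijective hk).injective.eq_iff, ellipticK,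
    abs_le, ← ellipticF_neg, hm, hm]
  constructor
  · rintro ⟨⟨h1, h2⟩, rfl⟩
    exact (Real.arcsin_sin h1 h2).symm
  · rintro rfl
    exact ⟨⟨Real.neg_pi_div_two_le_arcsin c, Real.arcsin_le_pi_div_two c⟩,
      Real.sin_arcsin hc.1 hc.2⟩

/-! ### The explicit solution: continuity, and analyticity off Σ -/

/-- The solution `u` of `sn(a u / √(1 - α²); α) = cos (a x) / cosh (a y)` in the slab
`|a u / √(1 - α²)| ≤ K(α)`. -/
noncomputable def maximalGraph (a α : ℝ) (p : ℝ × ℝ) : ℝ :=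
  Real.sqrt (1 - α ^ 2) / a *
    ellipticF α (Real.arcsin (Real.cos (a * p.1) / Real.cosh (a * p.2)))

/-- The radicand in the first derivatives of `maximalGraph`. -/
noncomputable def maximalGraphRadicand (a α x y : ℝ) : ℝ :=
  (Real.cosh (a * y) ^ 2 - Real.cos (a * x) ^ 2) *
    (Real.cosh (a * y) ^ 2 - α ^ 2 * Real.cos (a * x) ^ 2)

theorem cos_div_cosh_mem_Icc (s t : ℝ) : Real.cos s / Real.cosh t ∈ Set.Icc (-1 : ℝ) 1 := by
  have h := Real.cosh_pos t
  have h1 := Real.one_le_cosh t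
  rw [Set.mem_Icc, le_div_iff₀ h, div_le_one h]
  constructor <;> linarith [Real.cos_le_one s, Real.neg_one_le_cos s]

theorem continuous_maximalGraph {α : ℝ} (a : ℝ) (hα : |α| < 1) :
    Continuous (maximalGraph a α) := by
  have hF : Continuous (ellipticF α) :=
    continuous_iff_continuousAt.2 fun φ => (ellipticF_hasDerivAt hα φ).continuousAt
  unfold maximalGraph
  refine continuous_const.mul (hF.comp (Real.continuous_arcsin.comp ?_))
  exact Continuous.div (by fun_prop) (by fun_prop) fun p => (Real.cosh_pos _).ne'

/-- If y ≠ 0 then cosh ay > 1 ≥ |cos ax|; if y = 0 then sin ax ≠ 0 off Σ. -/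
theorem cos_sq_lt_cosh_sq {a : ℝ} (ha : a ≠ 0) {p : ℝ × ℝ} (hp : p ∉ singularPoints a) :
    Real.cos (a * p.1) ^ 2 < Real.cosh (a * p.2) ^ 2 := by
  by_cases hy : p.2 = 0
  · have hs : Real.sin (a * p.1) ≠ 0 := by
      intro h
      obtain ⟨n, hn⟩ := Real.sin_eq_zero_iff.1 h
      refine hp ⟨n, Prod.ext ?_ hy⟩
      field_simp
      linarith
    have := Real.sin_sq_add_cos_sq (a * p.1)
    have := sq_pos_of_ne_zero hs
    simp only [hy, mul_zero, Real.cosh_zero]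
    linarith
  · have : 1 < Real.cosh (a * p.2) := Real.one_lt_cosh.2 (mul_ne_zero ha hy)
    nlinarith [Real.cos_sq_le_one (a * p.1)]

theorem isClosed_singularPoints {a : ℝ} (ha : a ≠ 0) : IsClosed (singularPoints a) := by
  have : singularPoints a = {p | Real.cosh (a * p.2) ^ 2 - Real.cos (a * p.1) ^ 2 ≤ 0} := by
    ext p
    constructor
    · rintro ⟨n, rfl⟩
      have : a * (Real.pi * n / a) = n * Real.pi := by field_simp
      have h1 : Real.cos (a * (Real.pi * n / a)) ^ 2 = 1 := by
        rw [this, ← sq_abs, Real.abs_cos_int_mul_pi, one_pow]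
      simp [h1]
    · intro h
      by_contra hp
      have := cos_sq_lt_cosh_sq ha hp
      simp only [Set.mem_ofPred_eq] at h
      linarith
  rw [this]
  exact isClosed_le (by fun_prop) continuous_const

theorem cos_div_cosh_ne {s t : ℝ} (h : Real.cos s ^ 2 < Real.cosh t ^ 2) :
    Real.cos s / Real.cosh t ≠ -1 ∧ Real.cos s / Real.cosh t ≠ 1 := by
  have hc := (Real.cosh_pos t).ne'
  constructor <;> intro he <;> rw [div_eq_iff hc] at he <;> rw [he] at h <;> linarith

theorem analyticAt_maximalGraph {a α : ℝ} (ha : a ≠ 0) (hα : |α| < 1) {p : ℝ × ℝ}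
    (hp : p ∉ singularPoints a) : AnalyticAt ℝ (maximalGraph a α) p := by
  obtain ⟨h1, h2⟩ := cos_div_cosh_ne (cos_sq_lt_cosh_sq ha hp)
  have hq : AnalyticAt ℝ (fun p : ℝ × ℝ => Real.cos (a * p.1) / Real.cosh (a * p.2)) p := by
    refine AnalyticAt.div ?_ ?_ (Real.cosh_pos _).ne'
    · exact Real.analyticAt_cos.fun_comp (analyticAt_const.mul analyticAt_fst)
    · exact Real.analyticAt_cosh.fun_comp (analyticAt_const.mul analyticAt_snd)
  have hs : AnalyticAt ℝ Real.arcsin (Real.cos (a * p.1) / Real.cosh (a * p.2)) :=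
    (Real.contDiffAt_arcsin h1 h2).analyticAt
  exact analyticAt_const.mul
    ((ellipticF_analyticAt hα _).fun_comp (AnalyticAt.fun_comp (x := p) hs hq))

/-! ### First derivatives and the space-like condition -/

theorem maximalGraphRadicand_factor_pos {α x y a : ℝ} (hα : |α| < 1) :
    0 < Real.cosh (a * y) ^ 2 - α ^ 2 * Real.cos (a * x) ^ 2 := by
  have h1 : α ^ 2 < 1 := (sq_lt_one_iff_abs_lt_one α).2 hα
  have h2 := Real.one_le_cosh (a * y)
  nlinarith [Real.cos_sq_le_one (a * x), sq_nonneg (Real.cos (a * x))]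

/-- Derivative of `F(arcsin (c t))` at a point where `c t = C / H` has modulus less than one. -/
theorem HasDerivAt.ellipticF_arcsin {α : ℝ} (hα : |α| < 1) {c : ℝ → ℝ} {c' t C H : ℝ}
    (hc : HasDerivAt c c' t) (hct : c t = C / H) (hH : 0 < H) (hCH : C ^ 2 < H ^ 2) :
    HasDerivAt (fun s => ellipticF α (Real.arcsin (c s)))
      (c' * H ^ 2 / √((H ^ 2 - C ^ 2) * (H ^ 2 - α ^ 2 * C ^ 2))) t := by
  have hsq : (C / H) ^ 2 < 1 := by rw [div_pow, div_lt_one (by positivity)]; exact hCH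
  have h1 : c t ≠ -1 := by rintro h; rw [← hct, h] at hsq; norm_num at hsq
  have h2 : c t ≠ 1 := by rintro h; rw [← hct, h] at hsq; norm_num at hsq
  have hle := abs_le.1 ((sq_lt_one_iff_abs_lt_one _).1 hsq).le
  have hsin : Real.sin (Real.arcsin (c t)) = C / H := by
    rw [hct, Real.sin_arcsin hle.1 hle.2]
  have h := (ellipticF_hasDerivAt hα _).comp t ((Real.hasDerivAt_arcsin h1 h2).comp t hc)
  convert! h using 1
  rw [Function.comp_apply, hsin, hct]
  -- Each of the two square roots contributes one factor 1/H, which produces the H² in the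
  -- numerator.
  have e1 : 1 - (C / H) ^ 2 = (H ^ 2 - C ^ 2) / H ^ 2 := by field_simp
  have e2 : 1 - α ^ 2 * (C / H) ^ 2 = (H ^ 2 - α ^ 2 * C ^ 2) / H ^ 2 := by field_simp
  rw [e1, e2, Real.sqrt_div' _ (sq_nonneg H), Real.sqrt_div' _ (sq_nonneg H), Real.sqrt_sq hH.le,
    Real.sqrt_mul (sub_pos.2 hCH).le]
  have hα2 : α ^ 2 < 1 := (sq_lt_one_iff_abs_lt_one α).2 hα
  have p1 : 0 < H ^ 2 - C ^ 2 := sub_pos.2 hCH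
  have p2 : 0 < H ^ 2 - α ^ 2 * C ^ 2 := by nlinarith [sq_nonneg C]
  have := Real.sqrt_pos.2 p1
  have := Real.sqrt_pos.2 p2
  field_simp

theorem partialX_maximalGraph {a α : ℝ} (ha : a ≠ 0) (hα : |α| < 1) {p : ℝ × ℝ}
    (hp : p ∉ singularPoints a) :
    partialX (maximalGraph a α) p = -(√(1 - α ^ 2) *
      (Real.sin (a * p.1) * Real.cosh (a * p.2))) / √(maximalGraphRadicand a α p.1 p.2) := by
  have hc : HasDerivAt (fun s => Real.cos (a * s) / Real.cosh (a * p.2))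
      (-Real.sin (a * p.1) * a / Real.cosh (a * p.2)) p.1 := by
    have := (((hasDerivAt_id p.1).const_mul a).cos).div_const (Real.cosh (a * p.2))
    simpa using this
  have h := (hc.ellipticF_arcsin hα rfl (Real.cosh_pos _) (cos_sq_lt_cosh_sq ha hp)).const_mul
    (√(1 - α ^ 2) / a)
  refine h.deriv.trans ?_
  have := (Real.cosh_pos (a * p.2)).ne'
  rw [maximalGraphRadicand]
  field_simp

theorem partialY_maximalGraph {a α : ℝ} (ha : a ≠ 0) (hα : |α| < 1) {p : ℝ × ℝ}
    (hp : p ∉ singularPoints a) :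
    partialY (maximalGraph a α) p = -(√(1 - α ^ 2) *
      (Real.cos (a * p.1) * Real.sinh (a * p.2))) / √(maximalGraphRadicand a α p.1 p.2) := by
  have hne := (Real.cosh_pos (a * p.2)).ne'
  have hc : HasDerivAt (fun s => Real.cos (a * p.1) / Real.cosh (a * s))
      (-(Real.cos (a * p.1) * (Real.sinh (a * p.2) * a)) / Real.cosh (a * p.2) ^ 2) p.2 := by
    have := (hasDerivAt_const p.2 (Real.cos (a * p.1))).div
      (((hasDerivAt_id p.2).const_mul a).cosh) hne
    simpa using! this
  have h := (hc.ellipticF_arcsin hα rfl (Real.cosh_pos _) (cos_sq_lt_cosh_sq ha hp)).const_mul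
    (√(1 - α ^ 2) / a)
  refine h.deriv.trans ?_
  rw [maximalGraphRadicand]
  field_simp

theorem maximalGraphRadicand_pos {a α : ℝ} (ha : a ≠ 0) (hα : |α| < 1) {p : ℝ × ℝ}
    (hp : p ∉ singularPoints a) : 0 < maximalGraphRadicand a α p.1 p.2 :=
  mul_pos (sub_pos.2 (cos_sq_lt_cosh_sq ha hp)) (maximalGraphRadicand_factor_pos hα)

theorem spaceLikeAt_maximalGraph {a α : ℝ} (ha : a ≠ 0) (hα0 : α ≠ 0) (hα : |α| < 1) {p : ℝ × ℝ}
    (hp : p ∉ singularPoints a) : SpaceLikeAt (maximalGraph a α) p := by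
  have hD := maximalGraphRadicand_pos ha hα hp
  have hα2 : α ^ 2 < 1 := (sq_lt_one_iff_abs_lt_one α).2 hα
  have hlt := cos_sq_lt_cosh_sq ha hp
  rw [SpaceLikeAt, Real.sqrt_lt' one_pos, partialX_maximalGraph ha hα hp,
    partialY_maximalGraph ha hα hp, div_pow, div_pow, Real.sq_sqrt hD.le, ← add_div,
    div_lt_iff₀ hD, neg_sq, neg_sq, mul_pow, mul_pow √(1 - α ^ 2), Real.sq_sqrt (by linarith),
    maximalGraphRadicand, mul_pow, mul_pow, Real.sin_sq, Real.sinh_sq]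
  have hC := Real.cos_sq_le_one (a * p.1)
  have hH := Real.one_le_cosh (a * p.2)
  generalize Real.cos (a * p.1) ^ 2 = C at *
  have hH2 : 1 ≤ Real.cosh (a * p.2) ^ 2 := by nlinarith
  generalize Real.cosh (a * p.2) ^ 2 = H at *
  -- The numerators of u_x² and u_y² add up to (1 - α²)(H - C), so |∇u|² < 1 is this inequality. The
  -- second factor is (H - 1) + α²(1 - C); when H = 1 its positivity needs C < 1 and α ≠ 0.
  have key : 0 < (H - C) * ((H - α ^ 2 * C) - (1 - α ^ 2)) := by
    refine mul_pos (sub_pos.2 hlt) ?_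
    rcases hH2.lt_or_eq with h | h
    · nlinarith [sq_nonneg α]
    · have : C < 1 := by linarith
      nlinarith [mul_pos (sq_pos_of_ne_zero hα0) (sub_pos.2 this)]
  nlinarith

/-! ### Second derivatives and the maximal surface equation -/

theorem HasDerivAt.neg_const_mul_div_sqrt {N D : ℝ → ℝ} {N' D' t : ℝ} (b : ℝ)
    (hN : HasDerivAt N N' t) (hD : HasDerivAt D (2 * D') t) (hpos : 0 < D t) :
    HasDerivAt (fun s => -(b * N s) / √(D s)) (-b * (N' * D t - N t * D') / (D t * √(D t))) t := by
  have hr := Real.sqrt_pos.2 hpos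
  have h := (hN.const_mul b).neg.div (hD.sqrt hpos.ne') hr.ne'
  convert! h using 1
  rw [Real.sq_sqrt hpos.le]
  field_simp
  rw [Real.sq_sqrt hpos.le]
  simp only [Pi.neg_apply]
  ring

theorem hasDerivAt_maximalGraphRadicand_left (a α x y : ℝ) :
    HasDerivAt (fun s => maximalGraphRadicand a α s y)
      (2 * (a * Real.cos (a * x) * Real.sin (a * x) *
        ((Real.cosh (a * y) ^ 2 - α ^ 2 * Real.cos (a * x) ^ 2) +
          α ^ 2 * (Real.cosh (a * y) ^ 2 - Real.cos (a * x) ^ 2)))) x := by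
  have h := (((hasDerivAt_id x).const_mul a).cos).pow 2
  have h1 := (h.const_sub (Real.cosh (a * y) ^ 2)).mul
    ((h.const_mul (α ^ 2)).const_sub (Real.cosh (a * y) ^ 2))
  convert! h1 using 1
  simp
  ring

theorem hasDerivAt_maximalGraphRadicand_right (a α x y : ℝ) :
    HasDerivAt (fun s => maximalGraphRadicand a α x s)
      (2 * (a * Real.cosh (a * y) * Real.sinh (a * y) *
        ((Real.cosh (a * y) ^ 2 - α ^ 2 * Real.cos (a * x) ^ 2) +
          (Real.cosh (a * y) ^ 2 - Real.cos (a * x) ^ 2)))) y := by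
  have h := (((hasDerivAt_id y).const_mul a).cosh).pow 2
  have h1 := (h.sub_const (Real.cos (a * x) ^ 2)).mul
    (h.sub_const (α ^ 2 * Real.cos (a * x) ^ 2))
  convert! h1 using 1
  simp
  ring

theorem eventually_left_notMem_singularPoints {a : ℝ} (ha : a ≠ 0) {p : ℝ × ℝ}
    (hp : p ∉ singularPoints a) : ∀ᶠ s in 𝓝 p.1, (s, p.2) ∉ singularPoints a :=
  (Continuous.prodMk_left p.2).continuousAt.eventually
    ((isClosed_singularPoints ha).isOpen_compl.mem_nhds hp)

theorem eventually_right_notMem_singularPoints {a : ℝ} (ha : a ≠ 0) {p : ℝ × ℝ}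
    (hp : p ∉ singularPoints a) : ∀ᶠ s in 𝓝 p.2, (p.1, s) ∉ singularPoints a :=
  (Continuous.prodMk_right p.1).continuousAt.eventually
    ((isClosed_singularPoints ha).isOpen_compl.mem_nhds hp)

theorem hasDerivAt_sin_const_mul (a x : ℝ) :
    HasDerivAt (fun s => Real.sin (a * s)) (a * Real.cos (a * x)) x := by
  simpa [mul_comm] using! ((hasDerivAt_id x).const_mul a).sin

theorem hasDerivAt_cosh_const_mul (a x : ℝ) :
    HasDerivAt (fun s => Real.cosh (a * s)) (a * Real.sinh (a * x)) x := by
  simpa [mul_comm] using! ((hasDerivAt_id x).const_mul a).cosh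

theorem hasDerivAt_sinh_const_mul (a x : ℝ) :
    HasDerivAt (fun s => Real.sinh (a * s)) (a * Real.cosh (a * x)) x := by
  simpa [mul_comm] using! ((hasDerivAt_id x).const_mul a).sinh

theorem partialX_partialX_maximalGraph {a α : ℝ} (ha : a ≠ 0) (hα : |α| < 1) {p : ℝ × ℝ}
    (hp : p ∉ singularPoints a) :
    partialX (partialX (maximalGraph a α)) p =
      -√(1 - α ^ 2) * (a * Real.cos (a * p.1) * Real.cosh (a * p.2) *
          maximalGraphRadicand a α p.1 p.2
        - Real.sin (a * p.1) * Real.cosh (a * p.2) * (a * Real.cos (a * p.1) * Real.sin (a * p.1) *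
        ((Real.cosh (a * p.2) ^ 2 - α ^ 2 * Real.cos (a * p.1) ^ 2) +
          α ^ 2 * (Real.cosh (a * p.2) ^ 2 - Real.cos (a * p.1) ^ 2))))
      / (maximalGraphRadicand a α p.1 p.2 * √(maximalGraphRadicand a α p.1 p.2)) := by
  have h := ((hasDerivAt_sin_const_mul a p.1).mul_const
    (Real.cosh (a * p.2))).neg_const_mul_div_sqrt √(1 - α ^ 2)
    (hasDerivAt_maximalGraphRadicand_left a α p.1 p.2) (maximalGraphRadicand_pos ha hα hp)
  refine (h.congr_of_eventuallyEq ?_).deriv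
  filter_upwards [eventually_left_notMem_singularPoints ha hp] with s hs
  exact partialX_maximalGraph ha hα hs

theorem partialY_partialX_maximalGraph {a α : ℝ} (ha : a ≠ 0) (hα : |α| < 1) {p : ℝ × ℝ}
    (hp : p ∉ singularPoints a) :
    partialY (partialX (maximalGraph a α)) p =
      -√(1 - α ^ 2) * (Real.sin (a * p.1) * (a * Real.sinh (a * p.2)) *
          maximalGraphRadicand a α p.1 p.2
        - Real.sin (a * p.1) * Real.cosh (a * p.2) *
          (a * Real.cosh (a * p.2) * Real.sinh (a * p.2) *
        ((Real.cosh (a * p.2) ^ 2 - α ^ 2 * Real.cos (a * p.1) ^ 2) +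
          (Real.cosh (a * p.2) ^ 2 - Real.cos (a * p.1) ^ 2))))
      / (maximalGraphRadicand a α p.1 p.2 * √(maximalGraphRadicand a α p.1 p.2)) := by
  have h := ((hasDerivAt_cosh_const_mul a p.2).const_mul
    (Real.sin (a * p.1))).neg_const_mul_div_sqrt √(1 - α ^ 2)
    (hasDerivAt_maximalGraphRadicand_right a α p.1 p.2) (maximalGraphRadicand_pos ha hα hp)
  refine (h.congr_of_eventuallyEq ?_).deriv
  filter_upwards [eventually_right_notMem_singularPoints ha hp] with s hs
  exact partialX_maximalGraph ha hα hs

theorem partialY_partialY_maximalGraph {a α : ℝ} (ha : a ≠ 0) (hα : |α| < 1) {p : ℝ × ℝ}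
    (hp : p ∉ singularPoints a) :
    partialY (partialY (maximalGraph a α)) p =
      -√(1 - α ^ 2) * (Real.cos (a * p.1) * (a * Real.cosh (a * p.2)) *
          maximalGraphRadicand a α p.1 p.2
        - Real.cos (a * p.1) * Real.sinh (a * p.2) *
          (a * Real.cosh (a * p.2) * Real.sinh (a * p.2) *
        ((Real.cosh (a * p.2) ^ 2 - α ^ 2 * Real.cos (a * p.1) ^ 2) +
          (Real.cosh (a * p.2) ^ 2 - Real.cos (a * p.1) ^ 2))))
      / (maximalGraphRadicand a α p.1 p.2 * √(maximalGraphRadicand a α p.1 p.2)) := by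
  have h := ((hasDerivAt_sinh_const_mul a p.2).const_mul
    (Real.cos (a * p.1))).neg_const_mul_div_sqrt √(1 - α ^ 2)
    (hasDerivAt_maximalGraphRadicand_right a α p.1 p.2) (maximalGraphRadicand_pos ha hα hp)
  refine (h.congr_of_eventuallyEq ?_).deriv
  filter_upwards [eventually_right_notMem_singularPoints ha hp] with s hs
  exact partialY_maximalGraph ha hα hs

/-- The polynomial identity behind the maximal surface equation, in `C = cos²`, `S = sin²`,
`H = cosh²`, `h = sinh²`. -/
theorem maximalGraph_polynomial_identity {m b C S H h D E G : ℝ} (hb : b = 1 - m)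
    (hS : S = 1 - C) (hh : h = H - 1) (hD : D = (H - C) * (H - m * C))
    (hE : E = (H - m * C) + m * (H - C)) (hG : G = (H - m * C) + (H - C)) :
    (D - b * C * h) * (D - S * E) + 2 * b * S * h * (D - H * G)
      + (D - b * S * H) * (D - h * G) = 0 := by
  subst hb hS hh hD hE hG
  ring

theorem maximalSurfaceEqAt_maximalGraph {a α : ℝ} (ha : a ≠ 0) (hα : |α| < 1) {p : ℝ × ℝ}
    (hp : p ∉ singularPoints a) : MaximalSurfaceEqAt (maximalGraph a α) p := by
  have hD := maximalGraphRadicand_pos ha hα hp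
  have hα2 : α ^ 2 < 1 := (sq_lt_one_iff_abs_lt_one α).2 hα
  have key := maximalGraph_polynomial_identity (m := α ^ 2)
    (Real.sq_sqrt (by linarith : (0 : ℝ) ≤ 1 - α ^ 2)) (Real.sin_sq (a * p.1))
    (Real.sinh_sq (a * p.2))
    (show maximalGraphRadicand a α p.1 p.2 = _ from rfl) rfl rfl
  rw [MaximalSurfaceEqAt, partialX_partialX_maximalGraph ha hα hp,
    partialY_partialX_maximalGraph ha hα hp, partialY_partialY_maximalGraph ha hα hp,
    partialX_maximalGraph ha hα hp, partialY_maximalGraph ha hα hp]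
  have hr := Real.sqrt_pos.2 hD
  have hr2 := Real.sq_sqrt hD.le
  generalize √(maximalGraphRadicand a α p.1 p.2) = r at *
  generalize maximalGraphRadicand a α p.1 p.2 = D at *
  generalize Real.cos (a * p.1) = C at *
  generalize Real.sin (a * p.1) = S at *
  generalize Real.cosh (a * p.2) = H at *
  generalize Real.sinh (a * p.2) = h at *
  generalize √(1 - α ^ 2) = b at *
  subst hr2
  field_simp
  -- All three terms of the equation share the factor -abCH; what remains involves only squares.
  linear_combination (-a * b * C * H) * key

/-! ### Failure of analyticity on Σ -/

theorem not_analyticAt_maximalGraph {a α : ℝ} (ha : a ≠ 0) (hα : |α| < 1) {p : ℝ × ℝ}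
    (hp : p ∈ singularPoints a) : ¬ AnalyticAt ℝ (maximalGraph a α) p := by
  intro h
  obtain ⟨n, rfl⟩ := hp
  set x := Real.pi * n / a with hx
  have hα2 : α ^ 2 < 1 := (sq_lt_one_iff_abs_lt_one α).2 hα
  have hcos : Real.cos (a * x) ^ 2 = 1 := by
    have : a * x = n * Real.pi := by rw [hx]; field_simp
    rw [this, ← sq_abs, Real.abs_cos_int_mul_pi, one_pow]
  have hg : AnalyticAt ℝ (fun s => maximalGraph a α (x, s)) 0 :=
    AnalyticAt.fun_comp (g := maximalGraph a α) (f := fun s => (x, s)) h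
      (analyticAt_const.prod analyticAt_id)
  have hzero : deriv (fun s => maximalGraph a α (x, s)) 0 = 0 := by
    have heven : (fun s => maximalGraph a α (x, -s)) = fun s => maximalGraph a α (x, s) := by
      ext s
      simp [maximalGraph]
    have := deriv_comp_neg (fun s => maximalGraph a α (x, s)) 0
    rw [heven, neg_zero] at this
    linarith
  have hlim : Tendsto (fun y => deriv (fun s => maximalGraph a α (x, s)) y ^ 2) (𝓝[≠] 0)
      (𝓝 0) := by
    have := (hg.deriv.continuousAt.pow 2).tendsto
    rw [Pi.pow_apply, hzero, zero_pow two_ne_zero] at this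
    exact this.mono_left nhdsWithin_le_nhds
  -- This is u_y² on the vertical line: there cos² = 1, so sinh² cancels against cosh² - 1.
  have hlim' : Tendsto (fun y => (1 - α ^ 2) / (Real.sinh (a * y) ^ 2 + (1 - α ^ 2))) (𝓝[≠] 0)
      (𝓝 1) := by
    have hc : ContinuousAt (fun y => (1 - α ^ 2) / (Real.sinh (a * y) ^ 2 + (1 - α ^ 2))) 0 := by
      refine ContinuousAt.div (by fun_prop) (by fun_prop) ?_
      simp
      linarith
    have := hc.tendsto
    simp only [mul_zero, Real.sinh_zero, ne_eq, OfNat.ofNat_ne_zero, not_false_eq_true, zero_pow,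
      zero_add] at this
    rw [div_self (by linarith)] at this
    exact this.mono_left nhdsWithin_le_nhds
  refine zero_ne_one (tendsto_nhds_unique hlim (hlim'.congr' ?_))
  filter_upwards [self_mem_nhdsWithin] with y hy
  have hy : y ≠ 0 := hy
  have hns : (x, y) ∉ singularPoints a := by
    rintro ⟨m, hm⟩
    exact hy (congrArg Prod.snd hm)
  have hd := partialY_maximalGraph ha hα hns
  rw [partialY] at hd
  have hD := maximalGraphRadicand_pos ha hα hns
  have hs : 0 < Real.sinh (a * y) ^ 2 :=
    sq_pos_of_ne_zero (Real.sinh_ne_zero.2 (mul_ne_zero ha hy))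
  simp only at hd hD
  rw [hd, div_pow, Real.sq_sqrt hD.le, neg_sq, mul_pow, mul_pow, hcos,
    Real.sq_sqrt (by linarith), maximalGraphRadicand, hcos, Real.cosh_sq]
  rw [mul_one, add_sub_cancel_right, add_sub_assoc, one_mul, mul_comm (1 - α ^ 2),
    mul_div_mul_left _ _ hs.ne']

/-! ### Assembly -/

theorem mainTheorem2 (a α : ℝ) (ha : 0 < a) (hα : α ∈ Set.Ioo (0 : ℝ) 1) :
    ∃ u : ℝ × ℝ → ℝ,
      (∀ x y z : ℝ,
        (|a * z / Real.sqrt (1 - α ^ 2)| ≤ ellipticK α ∧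
          jacobiSn (a * z / Real.sqrt (1 - α ^ 2)) α
            = Real.cos (a * x) / Real.cosh (a * y)) ↔ z = u (x, y)) ∧
      Continuous u ∧
      IsSpaceLikeSolutionOn u (singularPoints a)ᶜ ∧
      AnalyticOnNhd ℝ u (singularPoints a)ᶜ ∧
      ∀ p ∈ singularPoints a, ¬ AnalyticAt ℝ u p := by
  have hα1 : |α| < 1 := by rw [abs_of_pos hα.1]; exact hα.2
  have hα2 : α ^ 2 < 1 := (sq_lt_one_iff_abs_lt_one α).2 hα1
  have han : AnalyticOnNhd ℝ (maximalGraph a α) (singularPoints a)ᶜ :=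
    fun p hp => analyticAt_maximalGraph ha.ne' hα1 hp
  refine ⟨maximalGraph a α, fun x y z => ?_, continuous_maximalGraph a hα1,
    ⟨(isClosed_singularPoints ha.ne').isOpen_compl,
      fun p hp => (han p hp).contDiffAt.contDiffWithinAt,
      fun p hp => spaceLikeAt_maximalGraph ha.ne' hα.1.ne' hα1 hp,
      fun p hp => maximalSurfaceEqAt_maximalGraph ha.ne' hα1 hp⟩,
    han, fun p hp => not_analyticAt_maximalGraph ha.ne' hα1 hp⟩
  rw [abs_le_ellipticK_and_jacobiSn_eq_iff hα1 (cos_div_cosh_mem_Icc _ _), maximalGraph]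
  have hb : √(1 - α ^ 2) ≠ 0 := (Real.sqrt_pos.2 (by linarith)).ne'
  rw [div_eq_iff hb, div_mul_eq_mul_div, eq_div_iff ha.ne', mul_comm z a, mul_comm (ellipticF _ _)]
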